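/- Let $\Sigma$ be a finite connected triangle-free graph (non-empty, simple) with vertex set $V$ and edge set $E$, and put $\chi(\Sigma)=|V|-|E|$. Let $G_\Sigma=\langle e_v\ (v\in V)\mid [e_v,e_w]=1 \text{ for } \{v,w\}\in E\rangle$ be the associated right-angled Artin group, let $\pi:G_\Sigma\to\mathbb Z$ be the homomorphism with $\pi(e_v)=1$ for all $v$, let $H_\Sigma=\ker\pi$ (the Bestvina–Brady kernel), and for $n\ge 1$ let $\Gamma_n=\pi^{-1}(n\mathbb Z)$. For a finitely presented group $\Gamma$, let $\mathrm{def}(\Gamma)$ be the infimum, over all finite presentations $\Gamma\cong F/R$ ($F$ free of finite rank $d(F)$, $R$ the normal closure of a finite subset of $F$), of $d_F(R)-d(F)$, where $d_F(R)$ is the least number of elements whose normal closure in $F$ is $R$ (so the sign convention is "relations minus generators"). Then every $\Gamma_n$ with $n\ge1$ is finitely presented, the infimum is attained, and $$\mathrm{def}(\Gamma_n)=n\,(1-\chi(\Sigma))-1 .$$ In particular, $\mathrm{def}(\Gamma_n)\to\infty$ as $n\to\infty$ if and only if $H_\Sigma$ is not finitely presentable, that is, if and only if $\Sigma$ is not a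 tree. -/

import Mathlib

/-- The right-angled Artin group of a graph: one generator for each vertex, and for each edge
the relation saying that the generators at its two ends commute. -/
abbrev RAAG {V : Type*} (G : SimpleGraph V) : Type _ :=
  PresentedGroup {r : FreeGroup V | ∃ v w : V, G.Adj v w ∧
    r = FreeGroup.of v * FreeGroup.of w * (FreeGroup.of v)⁻¹ * (FreeGroup.of w)⁻¹}

namespace RAAG

/-- The homomorphism `π` from the right-angled Artin group onto (the multiplicative copy of) `ℤ`
that sends every standard generator to the generator `1` of `ℤ`. -/
def toInt {V : Type*} (G : SimpleGraph V) : RAAG G →* Multiplicative ℤ :=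
  PresentedGroup.toGroup (f := fun _ : V => Multiplicative.ofAdd (1 : ℤ)) (by
    rintro r ⟨v, w, -, rfl⟩
    simp)

/-- The Bestvina–Brady kernel `H = ker π`. -/
def bestvinaBrady {V : Type*} (G : SimpleGraph V) : Subgroup (RAAG G) :=
  (toInt G).ker

/-- The subgroup `Γ_n = π⁻¹(nℤ)`. -/
def levelSubgroup {V : Type*} (G : SimpleGraph V) (n : ℕ) : Subgroup (RAAG G) :=
  (Subgroup.zpowers (Multiplicative.ofAdd (n : ℤ))).comap (toInt G)

end RAAG

/-- The Euler characteristic of a finite graph, regarded as a one-dimensional complex: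
the number of vertices minus the number of edges. -/
noncomputable def graphEulerChar {V : Type*} (G : SimpleGraph V) : ℤ :=
  (Nat.card V : ℤ) - (Nat.card G.edgeSet : ℤ)

/-- For a normal subgroup `R` of `F`, the least number of elements whose conjugates in `F`
generate `R`, that is, the number `d_F(R)`. It is only used when such a finite number exists. -/
noncomputable def normalRank {F : Type*} [Group F] (R : Subgroup F) : ℕ :=
  sInf {k : ℕ | ∃ S : Finset F, S.card = k ∧ Subgroup.normalClosure (S : Set F) = R}

/-- The deficiencies `d_F(R) - d(F)` of all the finite presentations `F / R` of a group `Γ`.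
A finite presentation is given by a free group `F` of finite rank `m = d(F)` and a surjection
`F → Γ` whose kernel `R` is the normal closure of a finite set. -/
def presentationDeficiencies (Γ : Type*) [Group Γ] : Set ℤ :=
  {d : ℤ | ∃ (m : ℕ) (f : FreeGroup (Fin m) →* Γ), Function.Surjective f ∧
    f.ker.IsFinitelyNormallyGenerated ∧ d = (normalRank f.ker : ℤ) - (m : ℤ)}

/-- The deficiency of a finitely presented group (with the sign convention "relations minus
generators"): the infimum of the deficiencies of its finite presentations. -/
noncomputable def deficiency (Γ : Type*) [Group Γ] : ℤ :=
  sInf (presentationDeficiencies Γ)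

/-! Upper bound. The preimage of `nℤ` in the free group on `V` is free of rank `n(|V| - 1) + 1`. The
`n|E|` conjugates of the edge commutators by `v₀ ^ i`, `0 ≤ i < n`, normally generate there the
kernel of the map onto `Γ_n`. This Reidemeister–Schreier presentation (`exists_level_presentation`)
has relations minus generators at most `n(1 - χ) - 1`.

Lower bound. For a presentation `F / R` of a group, `dim (R/[F,R] ⊗ ℚ) - d(F)` depends only on the
group: it is `b₂ - b₁`, by Hopf's exact sequence. Since `R/[F,R]` is spanned by the relators, it
suffices that the `n|E|` relators above stay independent in it. `card_add_card_le` is this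
comparison in elementary form, and `exists_dual_functionals` gives the independence: for each edge a
representation by triangular `3 × 3` matrices over `ℚ[ℤ/n]` sends every relator of another edge to
`1` and that of the edge itself to a nontrivial matrix `1 + c E₁₃`. Conjugation by `g` multiplies
`c` by `ζ ^ π(g)` with `ζ ^ n = 1`, so the coefficients of `c` are invariant under `π⁻¹(nℤ)` and
separate the `n` conjugates. Triangle-freeness is what makes these representations exist.

Kernel. If `H` had a finite presentation, adjoining `v₀ ^ n` would present every `Γ_n` with numbers
of generators and relators independent of `n`; the lower bound then forces `χ ≥ 1`, which for a
connected graph means a tree. Conversely, for a tree `H` is free of finite rank, because the group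
is an explicit semidirect product of a free group with `ℤ`. -/

/-! ### Free groups as semidirect products with `ℤ`, and the preimage of `nℤ` -/

section FreeGroupShift

/-- The action of `ℤ` on the free group with basis `A × ℤ` that translates the basis. -/
def freeGroupShift (A : Type*) : Multiplicative ℤ →* MulAut (FreeGroup (A × ℤ)) where
  toFun k := FreeGroup.freeGroupCongr ((Equiv.refl A).prodCongr (Equiv.addRight k.toAdd))
  map_one' := by
    apply MulEquiv.toMonoidHom_injective
    ext ⟨a, i⟩
    simp
  map_mul' k l := by
    apply MulEquiv.toMonoidHom_injective
    ext ⟨a, i⟩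
    simp [add_assoc, add_comm k.toAdd]

@[simp]
theorem freeGroupShift_of {A : Type*} (k : Multiplicative ℤ) (a : A) (i : ℤ) :
    freeGroupShift A k (FreeGroup.of (a, i)) = FreeGroup.of (a, i + k.toAdd) := by
  simp [freeGroupShift]

open SemidirectProduct in
/-- A free group with a distinguished basis element is a semidirect product of a free group
with `ℤ`. The other basis elements are sent to elements of degree `ε`. -/
def freeGroupOptionEquiv (A : Type*) (ε : ℤ) :
    FreeGroup (Option A) ≃* FreeGroup (A × ℤ) ⋊[freeGroupShift A] Multiplicative ℤ :=
  MonoidHom.toMulEquiv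
    (FreeGroup.lift fun o => o.elim (inr (Multiplicative.ofAdd 1))
      fun a => inl (FreeGroup.of (a, 0)) * inr (Multiplicative.ofAdd ε))
    (lift
      (FreeGroup.lift fun p => FreeGroup.of none ^ p.2 *
        (FreeGroup.of (some p.1) * FreeGroup.of none ^ (-ε)) * FreeGroup.of none ^ (-p.2))
      (zpowersHom _ (FreeGroup.of none))
      (fun k => by
        ext ⟨a, i⟩
        have h : zpowersHom _ (FreeGroup.of none : FreeGroup (Option A)) k =
            FreeGroup.of none ^ k.toAdd := rfl
        simp only [MonoidHom.comp_apply, MulEquiv.toMonoidHom_eq_coe, MonoidHom.coe_coe,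
          freeGroupShift_of, FreeGroup.lift_apply_of, h, MulAut.conj_apply]
        group))
    (by
      ext o
      cases o <;> simp)
    (by
      have key (i : ℤ) : (inr (Multiplicative.ofAdd 1) :
          FreeGroup (A × ℤ) ⋊[freeGroupShift A] Multiplicative ℤ) ^ i =
            inr (Multiplicative.ofAdd i) := by
        rw [← map_zpow, ← ofAdd_zsmul]; simp
      apply hom_ext
      · ext1 ⟨a, i⟩
        have h := inl_aut (φ := freeGroupShift A) (Multiplicative.ofAdd i) (FreeGroup.of (a, 0))
        simp only [freeGroupShift_of, toAdd_ofAdd, zero_add] at h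
        simp only [MonoidHom.comp_apply, lift_inl, FreeGroup.lift_apply_of, map_mul, map_zpow,
          Option.elim, MonoidHom.id_apply]
        rw [h, map_inv, ← key i, ← key ε]
        group
      · ext1
        simp [zpowersHom_apply])

theorem freeGroupOptionEquiv_right {A : Type*} (g : FreeGroup (Option A)) :
    (freeGroupOptionEquiv A 1 g).right =
      FreeGroup.lift (fun _ => Multiplicative.ofAdd (1 : ℤ)) g := by
  have : (SemidirectProduct.rightHom.comp (freeGroupOptionEquiv A 1).toMonoidHom) =
      FreeGroup.lift (fun _ => Multiplicative.ofAdd (1 : ℤ)) := by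
    ext o
    cases o <;> simp [freeGroupOptionEquiv]
  exact DFunLike.congr_fun this g

open SemidirectProduct in
/-- The elements of a free group whose exponent sum is a multiple of `n` form a subgroup which is
free of rank `n * (r - 1) + 1`, where `r` is the rank of the group. -/
theorem exists_freeGroup_level {V : Type*} (v₀ : V) (n : ℕ) (hn : 1 ≤ n) :
    ∃ θ : FreeGroup (Option ({v // v ≠ v₀} × Fin n)) →* FreeGroup V,
      Function.Injective θ ∧ θ.range = (Subgroup.zpowers (Multiplicative.ofAdd (n : ℤ))).comap
        (FreeGroup.lift fun _ => Multiplicative.ofAdd (1 : ℤ)) := by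
  classical
  have : NeZero n := ⟨by omega⟩
  let A := {v // v ≠ v₀}
  -- Division with remainder: `((a, j), i)` goes to `(a, j + n * i)`, so translating `i` by one
  -- translates the image by `n`.
  let e : (A × Fin n) × ℤ ≃ A × ℤ := (Equiv.prodAssoc _ _ _).trans
    ((Equiv.refl A).prodCongr ((Equiv.prodComm _ _).trans (Int.divModEquiv n).symm))
  let M : FreeGroup ((A × Fin n) × ℤ) ⋊[freeGroupShift _] Multiplicative ℤ →*
      FreeGroup (A × ℤ) ⋊[freeGroupShift _] Multiplicative ℤ :=
    SemidirectProduct.map (FreeGroup.freeGroupCongr e).toMonoidHom (zpowGroupHom (n : ℤ))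
      (fun k => by
        ext ⟨⟨a, j⟩, i⟩
        simp only [MulEquiv.toMonoidHom_eq_coe, MonoidHom.coe_comp, MonoidHom.coe_coe,
          Function.comp_apply, freeGroupShift_of, FreeGroup.freeGroupCongr_apply,
          FreeGroup.map.of, zpowGroupHom_apply]
        congr 1
        simp only [Equiv.trans_apply, Equiv.prodAssoc_apply, Equiv.prodCongr_apply, Prod.map,
          Equiv.refl_apply, Equiv.prodComm_apply, Prod.swap_prod_mk, Int.divModEquiv_symm_apply, e]
        congr 1
        change _ = (_ : ℤ) + n * k.toAdd
        ring)
  let E := freeGroupOptionEquiv A 1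
  let N : FreeGroup (Option A) ≃* FreeGroup V :=
    FreeGroup.freeGroupCongr (Equiv.optionSubtypeNe v₀)
  have hM (x) : M x = ⟨FreeGroup.freeGroupCongr e x.left, x.right ^ (n : ℤ)⟩ := rfl
  have hMinj : Function.Injective M := by
    intro x y h
    rw [hM, hM, SemidirectProduct.ext_iff] at h
    refine SemidirectProduct.ext (MulEquiv.injective _ h.1) ?_
    exact zpow_left_injective (n := (n : ℤ)) (by omega) h.2
  have hN (g) : FreeGroup.lift (fun _ => Multiplicative.ofAdd (1 : ℤ)) (N g) = (E g).right := by
    rw [freeGroupOptionEquiv_right]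
    simp only [N, FreeGroup.freeGroupCongr_apply, FreeGroup.map_eq_lift]
    rw [← MonoidHom.comp_apply]
    congr 1
    ext
    simp
  -- On the source the non-distinguished generators have degree `0`, on the target degree `1`; this
  -- is the reason for the parameter `ε`.
  refine ⟨N.toMonoidHom.comp (E.symm.toMonoidHom.comp
    (M.comp (freeGroupOptionEquiv (A × Fin n) 0).toMonoidHom)), ?_, ?_⟩
  · exact N.injective.comp (E.symm.injective.comp (hMinj.comp (MulEquiv.injective _)))
  · ext g
    obtain ⟨g, rfl⟩ := N.surjective g
    obtain ⟨g, rfl⟩ := E.symm.surjective g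
    rw [Subgroup.mem_comap, hN, E.apply_symm_apply, MonoidHom.mem_range,
      Subgroup.mem_zpowers_iff]
    constructor
    · rintro ⟨x, hx⟩
      have hx := E.symm.injective (N.injective hx)
      rw [← hx]
      refine ⟨((freeGroupOptionEquiv (A × Fin n) 0) x).right.toAdd, ?_⟩
      change _ = (((freeGroupOptionEquiv (A × Fin n) 0) x).right) ^ (n : ℤ)
      apply Multiplicative.toAdd.injective
      simp [mul_comm]
    · rintro ⟨k, hk⟩
      refine ⟨(freeGroupOptionEquiv (A × Fin n) 0).symm
        ⟨(FreeGroup.freeGroupCongr e).symm g.left, Multiplicative.ofAdd k⟩, ?_⟩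
      simp only [MonoidHom.comp_apply, MulEquiv.toMonoidHom_eq_coe, MonoidHom.coe_coe,
        MulEquiv.apply_symm_apply, hM]
      congr 2
      refine SemidirectProduct.ext rfl ?_
      rw [← hk]
      apply Multiplicative.toAdd.injective
      simp [mul_comm]

end FreeGroupShift

/-! ### A group of triangular matrices -/

section TwistedHeisenberg

/-- The group of upper triangular `3 × 3` matrices `!![s, b, c; 0, l, a; 0, 0, 1]`. -/
@[ext]
structure TwistedHeisenberg (k : Type*) [CommRing k] where
  s : kˣ
  l : kˣ
  a : k
  b : k
  c : k

namespace TwistedHeisenberg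

variable {k : Type*} [CommRing k]

instance : Mul (TwistedHeisenberg k) :=
  ⟨fun x y => ⟨x.s * y.s, x.l * y.l, x.l * y.a + x.a, x.s * y.b + x.b * y.l,
    x.s * y.c + x.b * y.a + x.c⟩⟩

instance : One (TwistedHeisenberg k) := ⟨⟨1, 1, 0, 0, 0⟩⟩

instance : Inv (TwistedHeisenberg k) :=
  ⟨fun x => ⟨x.s⁻¹, x.l⁻¹, -(↑x.l⁻¹ * x.a), -(↑x.s⁻¹ * x.b * ↑x.l⁻¹),
    ↑x.s⁻¹ * (x.b * ↑x.l⁻¹ * x.a - x.c)⟩⟩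

@[simp] theorem mul_s (x y : TwistedHeisenberg k) : (x * y).s = x.s * y.s := rfl
@[simp] theorem mul_l (x y : TwistedHeisenberg k) : (x * y).l = x.l * y.l := rfl
@[simp] theorem mul_a (x y : TwistedHeisenberg k) : (x * y).a = x.l * y.a + x.a := rfl
@[simp] theorem mul_b (x y : TwistedHeisenberg k) : (x * y).b = x.s * y.b + x.b * y.l := rfl
@[simp] theorem mul_c (x y : TwistedHeisenberg k) :
    (x * y).c = x.s * y.c + x.b * y.a + x.c := rfl
@[simp] theorem one_s : (1 : TwistedHeisenberg k).s = 1 := rfl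
@[simp] theorem one_l : (1 : TwistedHeisenberg k).l = 1 := rfl
@[simp] theorem one_a : (1 : TwistedHeisenberg k).a = 0 := rfl
@[simp] theorem one_b : (1 : TwistedHeisenberg k).b = 0 := rfl
@[simp] theorem one_c : (1 : TwistedHeisenberg k).c = 0 := rfl
@[simp] theorem inv_s (x : TwistedHeisenberg k) : x⁻¹.s = x.s⁻¹ := rfl
@[simp] theorem inv_l (x : TwistedHeisenberg k) : x⁻¹.l = x.l⁻¹ := rfl
@[simp] theorem inv_a (x : TwistedHeisenberg k) : x⁻¹.a = -(↑x.l⁻¹ * x.a) := rfl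
@[simp] theorem inv_b (x : TwistedHeisenberg k) : x⁻¹.b = -(↑x.s⁻¹ * x.b * ↑x.l⁻¹) := rfl
@[simp] theorem inv_c (x : TwistedHeisenberg k) :
    x⁻¹.c = ↑x.s⁻¹ * (x.b * ↑x.l⁻¹ * x.a - x.c) := rfl

instance : Group (TwistedHeisenberg k) :=
  Group.ofLeftAxioms
    (fun x y z => by ext <;> simp <;> ring)
    (fun x => by ext <;> simp)
    (fun x => by ext <;> simp; ring)

/-- The diagonal entry `s` as a homomorphism. -/
def sHom : TwistedHeisenberg k →* kˣ where
  toFun := s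
  map_one' := rfl
  map_mul' _ _ := rfl

/-- The subgroup of the elementary matrices `1 + c E₁₃`. -/
def corner : Subgroup (TwistedHeisenberg k) where
  carrier := {x | x.s = 1 ∧ x.l = 1 ∧ x.a = 0 ∧ x.b = 0}
  mul_mem' := by
    rintro x y ⟨h1, h2, h3, h4⟩ ⟨h5, h6, h7, h8⟩
    simp [h1, h2, h3, h4, h5, h6, h7, h8]
  one_mem' := by simp
  inv_mem' := by
    rintro x ⟨h1, h2, h3, h4⟩
    simp [h1, h2, h3, h4]

theorem mem_corner {x : TwistedHeisenberg k} :
    x ∈ corner ↔ x.s = 1 ∧ x.l = 1 ∧ x.a = 0 ∧ x.b = 0 := Iff.rfl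

theorem c_mul_of_mem_corner {x y : TwistedHeisenberg k} (hx : x ∈ corner) :
    (x * y).c = x.c + y.c := by
  obtain ⟨h1, -, -, h4⟩ := hx
  simp [h1, h4, add_comm]

/-- The two outer diagonal entries of `g` are `g.s` and `1`, so conjugation scales `E₁₃` by their
quotient. -/
theorem conj_eq (g : TwistedHeisenberg k) {x : TwistedHeisenberg k} (hx : x ∈ corner) :
    g * x * g⁻¹ = ⟨1, 1, 0, 0, g.s * x.c⟩ := by
  obtain ⟨h1, h2, h3, h4⟩ := hx
  rw [mul_inv_eq_iff_eq_mul]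
  ext <;> simp [h1, h2, h3, h4, add_comm]

instance : (corner (k := k)).Normal where
  conj_mem x hx g := by
    rw [conj_eq g hx]
    simp [mem_corner]

end TwistedHeisenberg

end TwistedHeisenberg

/-! ### Independence of the edge relators -/

section RelatorFunctionals

variable {V : Type*} (G : SimpleGraph V)

/-- The commutator of two basis elements of a free group. -/
def basisCommutator (v w : V) : FreeGroup V :=
  FreeGroup.of v * FreeGroup.of w * (FreeGroup.of v)⁻¹ * (FreeGroup.of w)⁻¹

theorem basisCommutator_inv (v w : V) : (basisCommutator v w)⁻¹ = basisCommutator w v := by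
  simp [basisCommutator, mul_assoc]

/-- The defining relators of a right-angled Artin group. -/
def raagRelators : Set (FreeGroup V) :=
  {r | ∃ v w : V, G.Adj v w ∧
    r = FreeGroup.of v * FreeGroup.of w * (FreeGroup.of v)⁻¹ * (FreeGroup.of w)⁻¹}

/-- One relator for each edge, with a choice of orientation. -/
noncomputable def edgeRelator (e : G.edgeSet) : FreeGroup V :=
  basisCommutator (Quot.out e.1).1 (Quot.out e.1).2

variable {G}

theorem edge_out (e : G.edgeSet) : s((Quot.out e.1).1, (Quot.out e.1).2) = e.1 :=
  Quot.out_eq e.1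

theorem edge_out_adj (e : G.edgeSet) : G.Adj (Quot.out e.1).1 (Quot.out e.1).2 := by
  rw [← SimpleGraph.mem_edgeSet, edge_out]
  exact e.2

theorem edgeRelator_mem (e : G.edgeSet) : edgeRelator G e ∈ raagRelators G :=
  ⟨_, _, edge_out_adj e, rfl⟩

theorem normalClosure_range_edgeRelator :
    Subgroup.normalClosure (Set.range (edgeRelator G)) =
      Subgroup.normalClosure (raagRelators G) := by
  apply le_antisymm
  · apply Subgroup.normalClosure_mono
    rintro _ ⟨e, rfl⟩
    exact edgeRelator_mem e
  · apply Subgroup.normalClosure_le_normal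
    rintro _ ⟨v, w, h, rfl⟩
    have h1 := Subgroup.subset_normalClosure (Set.mem_range_self (f := edgeRelator G) ⟨s(v, w), h⟩)
    rcases Sym2.eq_iff.1 (edge_out (⟨s(v, w), h⟩ : G.edgeSet)) with ⟨h2, h3⟩ | ⟨h2, h3⟩
    · rw [edgeRelator, h2, h3] at h1
      exact h1
    · rw [edgeRelator, h2, h3, ← basisCommutator_inv] at h1
      exact inv_mem_iff.1 h1

open Classical in
/-- For an edge `{v₀, w₀}` of a triangle-free graph, a triangular representation of the free group
on the vertices in which only the relator of this edge is not killed. -/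
noncomputable def edgeRepresentation {k : Type*} [CommRing k] (ζ : kˣ) (G : SimpleGraph V)
    (v₀ w₀ : V) : FreeGroup V →* TwistedHeisenberg k :=
  FreeGroup.lift fun u => ⟨ζ, if G.Adj v₀ u then 1 else ζ, if u = v₀ then 1 else 0,
    if u = w₀ then 1 else 0, 0⟩

-- Look at the two diagonal `2 × 2` blocks. In the lower one, `v₀` is the only non-diagonal image
-- and the neighbours of `v₀` map to the identity. In the upper one, `w₀` is the only non-diagonal
-- image and the neighbours of `w₀` map to the scalar `ζ`, since by triangle-freeness they are not
-- adjacent to `v₀`. So adjacent vertices commute in both blocks, and only the corner can see the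
-- commutator.
open Classical in
theorem edgeRepresentation_basisCommutator {k : Type*} [CommRing k] (ζ : kˣ)
    (htri : G.CliqueFree 3) {v₀ w₀ v w : V} (h₀ : G.Adj v₀ w₀) (h : G.Adj v w) :
    edgeRepresentation ζ G v₀ w₀ (basisCommutator v w) = ⟨1, 1, 0, 0,
      (if v = w₀ ∧ w = v₀ then 1 else 0) - (if w = w₀ ∧ v = v₀ then 1 else 0)⟩ := by
  have key {u : V} (hu : G.Adj w₀ u) : ¬ G.Adj v₀ u := fun hv =>
    htri {v₀, w₀, u} (SimpleGraph.is3Clique_triple_iff.2 ⟨h₀, hv, hu⟩)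
  have hne := h.ne
  have hne0 := h₀.ne
  simp only [basisCommutator, map_mul, map_inv, mul_inv_eq_iff_eq_mul, edgeRepresentation,
    FreeGroup.lift_apply_of]
  ext
  · simp
  · simp [mul_comm]
  · by_cases h1 : v = v₀
    · subst h1
      simp [h, hne.symm]
    · by_cases h2 : w = v₀
      · subst h2
        simp [h.symm, h1]
      · simp [h1, h2]
  · by_cases h1 : v = w₀
    · subst h1
      simp [key h, hne.symm]
    · by_cases h2 : w = w₀
      · subst h2
        simp [key h.symm, h1]
      · simp [h1, h2]
  · by_cases h1 : v = w₀ <;> by_cases h2 : w = v₀ <;> by_cases h3 : w = w₀ <;>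
      by_cases h4 : v = v₀ <;> simp_all

theorem edgeRepresentation_mem_corner {k : Type*} [CommRing k] (ζ : kˣ)
    (htri : G.CliqueFree 3) {v₀ w₀ : V} (h₀ : G.Adj v₀ w₀) {r : FreeGroup V}
    (hr : r ∈ Subgroup.normalClosure (raagRelators G)) :
    edgeRepresentation ζ G v₀ w₀ r ∈ TwistedHeisenberg.corner := by
  have : Subgroup.normalClosure (raagRelators G) ≤
      TwistedHeisenberg.corner.comap (edgeRepresentation ζ G v₀ w₀) := by
    apply Subgroup.normalClosure_le_normal
    rintro _ ⟨v, w, h, rfl⟩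
    simp only [SetLike.mem_coe, Subgroup.mem_comap]
    rw [← basisCommutator, edgeRepresentation_basisCommutator ζ htri h₀ h]
    simp [TwistedHeisenberg.mem_corner]
  exact this hr

theorem edgeRepresentation_s {k : Type*} [CommRing k] (ζ : kˣ) (G : SimpleGraph V)
    (v₀ w₀ : V) (g : FreeGroup V) :
    (edgeRepresentation ζ G v₀ w₀ g).s =
      ζ ^ (FreeGroup.lift (fun _ => Multiplicative.ofAdd (1 : ℤ)) g).toAdd := by
  have : TwistedHeisenberg.sHom.comp (edgeRepresentation ζ G v₀ w₀) =
      (zpowersHom _ ζ).comp (FreeGroup.lift (fun _ => Multiplicative.ofAdd (1 : ℤ))) := by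
    ext v
    simp [TwistedHeisenberg.sHom, edgeRepresentation]
  exact DFunLike.congr_fun this g

open Classical in
/-- In a triangle-free graph, the relators of the level subgroup `Γ_n` of the right-angled Artin
group are linearly independent modulo the commutators with `π⁻¹(nℤ)`: there are invariant
functionals dual to them. -/
theorem exists_dual_functionals (htri : G.CliqueFree 3) (v₁ : V) (n : ℕ) (hn : 1 ≤ n) :
    ∃ c : FreeGroup V → (G.edgeSet × Fin n → ℚ),
      (∀ r ∈ Subgroup.normalClosure (raagRelators G),
        ∀ s ∈ Subgroup.normalClosure (raagRelators G), c (r * s) = c r + c s) ∧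
      (∀ g ∈ (Subgroup.zpowers (Multiplicative.ofAdd (n : ℤ))).comap
          (FreeGroup.lift fun _ => Multiplicative.ofAdd (1 : ℤ)),
        ∀ r ∈ Subgroup.normalClosure (raagRelators G), c (g * r * g⁻¹) = c r) ∧
      ∀ (e : G.edgeSet) (i : Fin n),
        c (FreeGroup.of v₁ ^ (i : ℕ) * edgeRelator G e * (FreeGroup.of v₁ ^ (i : ℕ))⁻¹) =
          Pi.single (e, i) 1 := by
  have : NeZero n := ⟨by omega⟩
  -- The scalars are the group algebra `ℚ[ℤ/n]`, with `ζ` the class of `1`: its powers `ζ ^ i`, `0 ≤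
  -- i < n`, form a basis and `ζ ^ n = 1`.
  let u : Multiplicative (ZMod n) →* (MonoidAlgebra ℚ (Multiplicative (ZMod n)))ˣ :=
    (Units.map (MonoidAlgebra.of ℚ (Multiplicative (ZMod n)))).comp toUnits.toMonoidHom
  let ζ := u (Multiplicative.ofAdd 1)
  have hu (z : ℤ) : ζ ^ z = u (Multiplicative.ofAdd (z : ZMod n)) := by
    rw [← map_zpow, ← ofAdd_zsmul, zsmul_one]
  let ρ (e : G.edgeSet) := edgeRepresentation ζ G (Quot.out e.1).1 (Quot.out e.1).2
  have hρ (e : G.edgeSet) {r : FreeGroup V} (hr : r ∈ Subgroup.normalClosure (raagRelators G)) :=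
    edgeRepresentation_mem_corner ζ htri (edge_out_adj e) hr
  have hconj (e : G.edgeSet) (g : FreeGroup V) {r : FreeGroup V}
      (hr : r ∈ Subgroup.normalClosure (raagRelators G)) :
      (ρ e (g * r * g⁻¹)).c =
        u (Multiplicative.ofAdd (((FreeGroup.lift (fun _ : V =>
          Multiplicative.ofAdd (1 : ℤ)) g).toAdd : ℤ) : ZMod n)) * (ρ e r).c := by
    rw [map_mul, map_mul, map_inv, TwistedHeisenberg.conj_eq _ (hρ e hr), ← hu,
      ← edgeRepresentation_s ζ G]
  -- The sign is there because the chosen orientation of the edge commutator gives corner entry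
  -- `-1`.
  refine ⟨fun r p => -(ρ p.1 r).c.coeff (Multiplicative.ofAdd ((p.2 : ℕ) : ZMod n)), ?_, ?_, ?_⟩
  · intro r hr s hs
    ext p
    simp only [map_mul, TwistedHeisenberg.c_mul_of_mem_corner (hρ p.1 hr), Pi.add_apply, ρ,
      MonoidAlgebra.coeff_add, Finsupp.add_apply]
    ring
  · intro g hg r hr
    ext p
    obtain ⟨z, hz⟩ := Subgroup.mem_zpowers_iff.1 (Subgroup.mem_comap.1 hg)
    simp only [hconj p.1 g hr]
    rw [← hz]
    simp
  · intro e i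
    ext ⟨e', j⟩
    have h1 := hconj e' (FreeGroup.of v₁ ^ (i : ℕ))
      (Subgroup.subset_normalClosure (edgeRelator_mem e))
    have h2 : (ρ e' (edgeRelator G e)).c = if e = e' then -1 else 0 := by
      simp only [ρ, edgeRelator]
      rw [edgeRepresentation_basisCommutator ζ htri (edge_out_adj e') (edge_out_adj e)]
      have h3 : ¬ ((Quot.out e.1).1 = (Quot.out e'.1).2 ∧
          (Quot.out e.1).2 = (Quot.out e'.1).1) := by
        rintro ⟨h4, h5⟩
        have h6 : e = e' := by
          apply Subtype.ext
          rw [← edge_out e, ← edge_out e', h4, h5, Sym2.eq_swap]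
        subst h6
        exact (edge_out_adj e).ne h4
      have h7 : ((Quot.out e.1).2 = (Quot.out e'.1).2 ∧
          (Quot.out e.1).1 = (Quot.out e'.1).1) ↔ e = e' := by
        constructor
        · rintro ⟨h4, h5⟩
          apply Subtype.ext
          rw [← edge_out e, ← edge_out e', h4, h5]
        · rintro rfl
          simp
      simp only [h3, h7, if_false]
      split_ifs <;> simp
    simp only [h1, h2]
    by_cases he : e = e'
    · subst he
      by_cases hij : i = j
      · subst hij
        simp [u]
      · have : ((i : ℕ) : ZMod n) ≠ ((j : ℕ) : ZMod n) := by
          rw [Ne, ZMod.natCast_eq_natCast_iff', Nat.mod_eq_of_lt i.2, Nat.mod_eq_of_lt j.2]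
          exact fun h => hij (Fin.ext h)
        simp [u, this, Ne.symm hij]
    · simp [he, Ne.symm he]

end RelatorFunctionals

/-! ### Comparing two presentations of a group -/

section DeficiencyBound

open Classical in
/-- The exponent sums of the basis elements in an element of a free group. -/
noncomputable def exponentSums (κ : Type*) : FreeGroup κ →* Multiplicative (κ → ℚ) :=
  FreeGroup.lift fun j => Multiplicative.ofAdd (Pi.single j 1)

/-- A comparison of two presentations `q` and `f` of a group `Γ`. If the relation module of `q`
has invariant functionals that are dual to a family of relations indexed by `I`, and `f` is given
by the relators in `S`, then the deficiency of `f` is at least `|I|` minus the number of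
generators of `q`. -/
theorem card_add_card_le {Γ ι κ I : Type*} [Group Γ] [Fintype ι] [Fintype κ] [Fintype I]
    [DecidableEq I]
    (q : FreeGroup ι →* Γ) (hq : Function.Surjective q)
    (f : FreeGroup κ →* Γ) (hf : Function.Surjective f)
    (S : Finset (FreeGroup κ)) (hS : Subgroup.normalClosure (S : Set (FreeGroup κ)) = f.ker)
    (c : FreeGroup ι → I → ℚ)
    (hadd : ∀ r ∈ q.ker, ∀ s ∈ q.ker, c (r * s) = c r + c s)
    (hinv : ∀ g, ∀ r ∈ q.ker, c (g * r * g⁻¹) = c r)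
    (ρ : I → FreeGroup ι) (hρ : ∀ i, ρ i ∈ q.ker) (hcρ : ∀ i, c (ρ i) = Pi.single i 1) :
    Fintype.card I + Fintype.card κ ≤ S.card + Fintype.card ι := by
  classical
  choose φ₀ hφ₀ using fun j => hq (f (FreeGroup.of j))
  choose ψ₀ hψ₀ using fun j => hf (q (FreeGroup.of j))
  let φ : FreeGroup κ →* FreeGroup ι := FreeGroup.lift φ₀
  let ψ : FreeGroup ι →* FreeGroup κ := FreeGroup.lift ψ₀
  have hφ (x) : q (φ x) = f x := by
    have : q.comp φ = f := by ext; simp [φ, hφ₀]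
    exact DFunLike.congr_fun this x
  have hψ (x) : f (ψ x) = q x := by
    have : f.comp ψ = q := by ext; simp [ψ, hψ₀]
    exact DFunLike.congr_fun this x
  -- `δ` measures how far `φ ∘ ψ` is from the identity. It is a crossed homomorphism into `q.ker`,
  -- and invariance of `c` turns `c ∘ δ` into a homomorphism.
  let δ (x : FreeGroup ι) : FreeGroup ι := x⁻¹ * φ (ψ x)
  have hδ (x) : δ x ∈ q.ker := by simp [δ, MonoidHom.mem_ker, hφ, hψ]
  have hδmul (x y) : c (δ (x * y)) = c (δ x) + c (δ y) := by
    have : δ (x * y) = y⁻¹ * δ x * y⁻¹⁻¹ * δ y := by simp [δ, mul_assoc]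
    rw [this, hadd _ ((MonoidHom.normal_ker q).conj_mem _ (hδ x) _) _ (hδ y), hinv _ _ (hδ x)]
  let ev (x : FreeGroup κ) : κ → ℚ := (exponentSums κ x).toAdd
  have hev (x y) : ev (x * y) = ev x + ev y := by simp [ev]
  -- A pair `(w, h)` defines a functional on `f.ker`, tested on the relators `S`, and a homomorphism
  -- from `FreeGroup ι` to `ℚ`, tested on the basis. Injectivity of `T` is the desired inequality of
  -- dimensions.
  let T : (I → ℚ) × (κ → ℚ) →ₗ[ℚ] (S → ℚ) × (ι → ℚ) :=
    { toFun := fun p => (fun s => p.1 ⬝ᵥ c (φ s) + p.2 ⬝ᵥ ev s,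
        fun a => p.2 ⬝ᵥ ev (ψ (FreeGroup.of a)) + p.1 ⬝ᵥ c (δ (FreeGroup.of a)))
      map_add' := by
        intro x y
        ext <;> simp <;> ring
      map_smul' := by
        intro r x
        ext <;> simp <;> ring }
  have hT : Function.Injective T := by
    rw [← LinearMap.ker_eq_bot, LinearMap.ker_eq_bot']
    rintro ⟨w, h⟩ h0
    have hS0 (s) (hs : s ∈ S) : w ⬝ᵥ c (φ s) + h ⬝ᵥ ev s = 0 :=
      congr_fun (congr_arg Prod.fst h0) ⟨s, hs⟩
    have hι0 (a) : h ⬝ᵥ ev (ψ (FreeGroup.of a)) + w ⬝ᵥ c (δ (FreeGroup.of a)) = 0 :=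
      congr_fun (congr_arg Prod.snd h0) a
    have hΨ (x) : h ⬝ᵥ ev (ψ x) + w ⬝ᵥ c (δ x) = 0 := by
      let Ψ : FreeGroup ι →* Multiplicative ℚ := MonoidHom.mk' (fun x => Multiplicative.ofAdd
        (h ⬝ᵥ ev (ψ x) + w ⬝ᵥ c (δ x))) (fun x y => by
          rw [map_mul, hev, hδmul, ← ofAdd_add, dotProduct_add, dotProduct_add]
          congr 1
          ring)
      have : Ψ = 1 := by
        ext a
        exact congr_arg _ (hι0 a)
      exact congr_arg Multiplicative.toAdd (DFunLike.congr_fun this x)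
    have hφker {x} (hx : x ∈ f.ker) : φ x ∈ q.ker := by
      rw [MonoidHom.mem_ker, hφ]
      exact hx
    have hΦ (x) (hx : x ∈ f.ker) : w ⬝ᵥ c (φ x) + h ⬝ᵥ ev x = 0 := by
      have hΦadd (x) (hx : x ∈ f.ker) (y) (hy : y ∈ f.ker) :
          w ⬝ᵥ c (φ (x * y)) + h ⬝ᵥ ev (x * y) =
            (w ⬝ᵥ c (φ x) + h ⬝ᵥ ev x) + (w ⬝ᵥ c (φ y) + h ⬝ᵥ ev y) := by
        rw [map_mul, hev, hadd _ (hφker hx) _ (hφker hy), dotProduct_add, dotProduct_add]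
        ring
      have h1 := hΦadd 1 (one_mem _) 1 (one_mem _)
      rw [mul_one, left_eq_add] at h1
      let N : Subgroup (FreeGroup κ) :=
        { carrier := {x | x ∈ f.ker ∧ w ⬝ᵥ c (φ x) + h ⬝ᵥ ev x = 0}
          mul_mem' := by
            rintro x y ⟨hx, hx'⟩ ⟨hy, hy'⟩
            exact ⟨mul_mem hx hy, by rw [hΦadd x hx y hy, hx', hy', add_zero]⟩
          one_mem' := ⟨one_mem _, h1⟩
          inv_mem' := by
            rintro x ⟨hx, hx'⟩
            refine ⟨inv_mem hx, ?_⟩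
            have h2 := hΦadd x hx x⁻¹ (inv_mem hx)
            rw [mul_inv_cancel, h1, hx', zero_add] at h2
            exact h2.symm }
      have : N.Normal := ⟨by
        rintro x ⟨hx, hx'⟩ g
        refine ⟨(MonoidHom.normal_ker f).conj_mem _ hx _, ?_⟩
        have h3 : ev (g * x * g⁻¹) = ev x := by simp [ev]
        rw [map_mul, map_mul, map_inv, hinv _ _ (hφker hx), h3, hx']⟩
      have hle : Subgroup.normalClosure (S : Set (FreeGroup κ)) ≤ N := by
        apply Subgroup.normalClosure_le_normal
        intro s hs
        exact ⟨hS ▸ Subgroup.subset_normalClosure hs, hS0 s hs⟩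
      rw [← hS] at hx
      exact (hle hx).2
    -- Evaluate the first functional at `ψ (ρ i)`. As `φ (ψ (ρ i)) = ρ i * δ (ρ i)`, it exceeds the
    -- value of the second at `ρ i` by exactly `w i`.
    have hw : w = 0 := by
      ext i
      have h4 := hΦ (ψ (ρ i)) (by rw [MonoidHom.mem_ker, hψ]; exact hρ i)
      have h5 : φ (ψ (ρ i)) = ρ i * δ (ρ i) := by simp [δ]
      rw [h5, hadd _ (hρ i) _ (hδ _), hcρ, dotProduct_add, dotProduct_single, mul_one] at h4
      have h6 := hΨ (ρ i)
      simp only [Pi.zero_apply]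
      linarith
    subst hw
    simp only [zero_dotProduct, zero_add, add_zero] at hΦ hΨ
    -- Now `h` vanishes on `f.ker` and on the range of `ψ`, and every generator is a product of
    -- elements of these two.
    have hh : h = 0 := by
      ext j
      obtain ⟨y, hy⟩ := hq (f (FreeGroup.of j))
      have h7 := hΦ ((ψ y)⁻¹ * FreeGroup.of j) (by simp [MonoidHom.mem_ker, hψ, hy])
      have h8 : ev (FreeGroup.of j) = ev (ψ y) + ev ((ψ y)⁻¹ * FreeGroup.of j) := by
        rw [← hev, mul_inv_cancel_left]
      have h9 : h ⬝ᵥ ev (FreeGroup.of j) = h j := by simp [ev, exponentSums]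
      rw [← h9, h8, dotProduct_add, h7, hΨ, add_zero]
      rfl
    rw [hh]
    rfl
  have := LinearMap.finrank_le_finrank_of_injective hT
  simpa using this

end DeficiencyBound

/-! ### The presentation of `Γ_n` and its deficiency -/

section LevelPresentation

/-- The hypothesis makes the set of cardinalities nonempty, so `normalRank` is attained and is not
the default value `0` of `sInf`. -/
theorem exists_finset_card_eq_normalRank {F : Type*} [Group F] {R : Subgroup F}
    (hR : R.IsFinitelyNormallyGenerated) :
    ∃ S : Finset F, S.card = normalRank R ∧ Subgroup.normalClosure (S : Set F) = R := by
  obtain ⟨S, hS, h⟩ := hR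
  exact Nat.sInf_mem (s := {k | ∃ S : Finset F, S.card = k ∧
    Subgroup.normalClosure (S : Set F) = R}) ⟨_, hS.toFinset, rfl, by simpa using h⟩

theorem normalRank_le {F : Type*} [Group F] {R : Subgroup F} (S : Finset F)
    (h : Subgroup.normalClosure (S : Set F) = R) : normalRank R ≤ S.card :=
  Nat.sInf_le ⟨S, rfl, h⟩

/-- A presentation on an arbitrary finite set of generators gives a finite presentation in the
sense of the definition of deficiency. -/
theorem exists_presentation_fin {Γ ι : Type*} [Group Γ] [Fintype ι] (q : FreeGroup ι →* Γ)
    (hq : Function.Surjective q) (S : Finset (FreeGroup ι))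
    (hS : Subgroup.normalClosure (S : Set (FreeGroup ι)) = q.ker) :
    ∃ f : FreeGroup (Fin (Fintype.card ι)) →* Γ, Function.Surjective f ∧
      f.ker.IsFinitelyNormallyGenerated ∧ normalRank f.ker ≤ S.card := by
  classical
  let e : FreeGroup ι ≃* FreeGroup (Fin (Fintype.card ι)) :=
    FreeGroup.freeGroupCongr (Fintype.equivFin ι)
  have hker : Subgroup.normalClosure ((S.image e : Finset _) : Set (FreeGroup _)) =
      (q.comp e.symm.toMonoidHom).ker := by
    have h1 := Subgroup.map_normalClosure (S : Set (FreeGroup ι)) e.toMonoidHom e.surjective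
    rw [hS] at h1
    rw [Finset.coe_image]
    refine Eq.trans h1.symm ?_
    ext x
    constructor
    · rintro ⟨y, hy, rfl⟩
      simpa [MonoidHom.mem_ker] using hy
    · intro hx
      exact ⟨e.symm x, hx, e.apply_symm_apply x⟩
  exact ⟨q.comp e.symm.toMonoidHom, hq.comp e.symm.surjective,
    ⟨_, Finset.finite_toSet _, hker⟩, (normalRank_le _ hker).trans Finset.card_image_le⟩

variable {V : Type*} {G : SimpleGraph V}

/-- The projection from the free group on the vertices to the right-angled Artin group. -/
def raagMk (G : SimpleGraph V) : FreeGroup V →* RAAG G :=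
  PresentedGroup.mk _

theorem raagMk_surjective : Function.Surjective (raagMk G) :=
  PresentedGroup.mk_surjective _

theorem toInt_mk (g : FreeGroup V) :
    RAAG.toInt G (raagMk G g) =
      FreeGroup.lift (fun _ => Multiplicative.ofAdd (1 : ℤ)) g :=
  rfl

theorem mk_mem_levelSubgroup {n : ℕ} {g : FreeGroup V} :
    raagMk G g ∈ RAAG.levelSubgroup G n ↔
      g ∈ (Subgroup.zpowers (Multiplicative.ofAdd (n : ℤ))).comap
        (FreeGroup.lift fun _ => Multiplicative.ofAdd (1 : ℤ)) := by
  rw [RAAG.levelSubgroup, Subgroup.mem_comap, Subgroup.mem_comap, toInt_mk]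

theorem mk_eq_one {g : FreeGroup V} : raagMk G g = 1 ↔
    g ∈ Subgroup.normalClosure (raagRelators G) :=
  QuotientGroup.eq_one_iff g

theorem normalClosure_raagRelators_le (n : ℕ) :
    Subgroup.normalClosure (raagRelators G) ≤
      (Subgroup.zpowers (Multiplicative.ofAdd (n : ℤ))).comap
        (FreeGroup.lift fun _ => Multiplicative.ofAdd (1 : ℤ)) := fun g hg => by
  rw [← mk_mem_levelSubgroup (G := G), mk_eq_one.2 hg]
  exact one_mem _

/-- The Reidemeister–Schreier presentation of the level subgroup `Γ_n`: its generators come from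
a basis of `π⁻¹(nℤ)`, its relators are indexed by pairs of an edge and a residue mod `n`. -/
theorem exists_level_presentation (v₀ : V) (n : ℕ) (hn : 1 ≤ n) :
    ∃ (θ : FreeGroup (Option ({v // v ≠ v₀} × Fin n)) →* FreeGroup V)
      (q : FreeGroup (Option ({v // v ≠ v₀} × Fin n)) →* RAAG.levelSubgroup G n)
      (ρ : G.edgeSet × Fin n → FreeGroup (Option ({v // v ≠ v₀} × Fin n))),
      Function.Surjective q ∧ (∀ w, θ w ∈ (Subgroup.zpowers (Multiplicative.ofAdd (n : ℤ))).comap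
        (FreeGroup.lift fun _ => Multiplicative.ofAdd (1 : ℤ))) ∧
      q.ker = (Subgroup.normalClosure (raagRelators G)).comap θ ∧
      (∀ p, θ (ρ p) = FreeGroup.of v₀ ^ (p.2 : ℕ) * edgeRelator G p.1 *
        (FreeGroup.of v₀ ^ (p.2 : ℕ))⁻¹) ∧
      Subgroup.normalClosure (Set.range ρ) = q.ker := by
  have : NeZero n := ⟨by omega⟩
  obtain ⟨θ, hθinj, hθ⟩ := exists_freeGroup_level v₀ n hn
  have hmem (w) : θ w ∈ (Subgroup.zpowers (Multiplicative.ofAdd (n : ℤ))).comap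
        (FreeGroup.lift fun _ => Multiplicative.ofAdd (1 : ℤ)) := hθ ▸ ⟨w, rfl⟩
  let q : FreeGroup (Option ({v // v ≠ v₀} × Fin n)) →* RAAG.levelSubgroup G n :=
    ((raagMk G).comp θ).codRestrict _
      fun w => mk_mem_levelSubgroup.2 (hmem w)
  have hker : q.ker = (Subgroup.normalClosure (raagRelators G)).comap θ := by
    ext w
    rw [MonoidHom.mem_ker, Subtype.ext_iff, Subgroup.mem_comap, ← mk_eq_one]
    rfl
  have hR (p : G.edgeSet × Fin n) : FreeGroup.of v₀ ^ (p.2 : ℕ) * edgeRelator G p.1 *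
      (FreeGroup.of v₀ ^ (p.2 : ℕ))⁻¹ ∈ Subgroup.normalClosure (raagRelators G) :=
    Subgroup.normalClosure_normal.conj_mem _
      (Subgroup.subset_normalClosure (edgeRelator_mem p.1)) _
  have hR' (p : G.edgeSet × Fin n) : ∃ w, θ w = FreeGroup.of v₀ ^ (p.2 : ℕ) * edgeRelator G p.1 *
      (FreeGroup.of v₀ ^ (p.2 : ℕ))⁻¹ := by
    rw [← MonoidHom.mem_range, hθ]
    exact normalClosure_raagRelators_le n (hR p)
  choose ρ hρ using hR'
  refine ⟨θ, q, ρ, ?_, hmem, hker, hρ, ?_⟩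
  · rintro ⟨x, hx⟩
    obtain ⟨g, rfl⟩ := raagMk_surjective x
    rw [mk_mem_levelSubgroup, ← hθ] at hx
    obtain ⟨w, rfl⟩ := hx
    exact ⟨w, rfl⟩
  · apply le_antisymm
    · apply Subgroup.normalClosure_le_normal
      rintro _ ⟨p, rfl⟩
      rw [SetLike.mem_coe, hker, Subgroup.mem_comap, hρ]
      exact hR p
    -- By injectivity of `θ` the inclusion may be checked in the free group on `V`. There a
    -- conjugator `g` factors as an element of `θ.range` times `v₀ ^ i`, with `i` the degree of `g`
    -- modulo `n`.
    · have hle : Subgroup.normalClosure (raagRelators G) ≤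
          (Subgroup.normalClosure (Set.range ρ)).map θ := by
        rw [← normalClosure_range_edgeRelator, Subgroup.normalClosure, Subgroup.closure_le]
        intro r hr
        obtain ⟨_, ⟨e, rfl⟩, hr⟩ := Group.mem_conjugatesOfSet_iff.1 hr
        obtain ⟨g, rfl⟩ := isConj_iff.1 hr
        let z : ℤ := (FreeGroup.lift (fun _ : V => Multiplicative.ofAdd (1 : ℤ)) g).toAdd
        have hpos : (0 : ℤ) < n := by omega
        let i : Fin n := ⟨(z % n).toNat, by
          have := Int.emod_lt_of_pos z hpos
          omega⟩
        have hi : (((i : ℕ) : ℤ)) = z % n := Int.toNat_of_nonneg (Int.emod_nonneg _ hpos.ne')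
        have hg : g * (FreeGroup.of v₀ ^ (i : ℕ))⁻¹ ∈ θ.range := by
          rw [hθ, Subgroup.mem_comap, Subgroup.mem_zpowers_iff]
          refine ⟨z / n, ?_⟩
          apply Multiplicative.toAdd.injective
          have := Int.mul_ediv_add_emod z n
          simp only [toAdd_zpow, toAdd_ofAdd, map_mul, map_inv, map_pow, FreeGroup.lift_apply_of,
            toAdd_mul, toAdd_inv, toAdd_pow, smul_eq_mul, nsmul_eq_mul, mul_one]
          change _ = z + -((i : ℕ) : ℤ)
          rw [hi, mul_comm]
          linarith
        obtain ⟨w, hw⟩ := hg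
        refine ⟨w * ρ (e, i) * w⁻¹, Subgroup.normalClosure_normal.conj_mem _
          (Subgroup.subset_normalClosure (Set.mem_range_self (e, i))) _, ?_⟩
        simp only [map_mul, map_inv, hw, hρ]
        group
      intro w hw
      rw [hker] at hw
      obtain ⟨w', hw', h⟩ := hle hw
      rwa [← hθinj h]

/-- The relator count is kept for an arbitrary `S`, so that the bound also applies to the
presentations built from one of the kernel. -/
theorem card_edge_add_le_of_presentation [Finite V] (htri : G.CliqueFree 3) (v₀ : V) {n : ℕ}
    (hn : 1 ≤ n) {κ : Type*} [Fintype κ] (f : FreeGroup κ →* RAAG.levelSubgroup G n)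
    (hf : Function.Surjective f) (S : Finset (FreeGroup κ))
    (hS : Subgroup.normalClosure (S : Set (FreeGroup κ)) = f.ker) :
    (n : ℤ) * (1 - graphEulerChar G) - 1 ≤ (S.card : ℤ) - (Fintype.card κ : ℤ) := by
  classical
  have := Fintype.ofFinite V
  obtain ⟨θ, q, ρ, hq, hθ, hker, hρ, hcl⟩ := exists_level_presentation (G := G) v₀ n hn
  obtain ⟨c, hadd, hinv, hdual⟩ := exists_dual_functionals htri v₀ n hn
  have hmem {r} (hr : r ∈ q.ker) : θ r ∈ Subgroup.normalClosure (raagRelators G) := by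
    rw [hker] at hr
    exact hr
  have key := card_add_card_le q hq f hf S hS (fun x => c (θ x))
    (fun r hr s hs => by rw [map_mul, hadd _ (hmem hr) _ (hmem hs)])
    (fun g r hr => by rw [map_mul, map_mul, map_inv, hinv _ (hθ g) _ (hmem hr)])
    ρ (fun p => hcl ▸ Subgroup.subset_normalClosure ⟨p, rfl⟩)
    (fun p => by rw [hρ, hdual])
  have hV : 1 ≤ Fintype.card V := Fintype.card_pos_iff.2 ⟨v₀⟩
  simp only [Fintype.card_prod, Fintype.card_option, Fintype.card_fin,
    Fintype.card_subtype_compl, Fintype.card_subtype_eq] at key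
  have key' : (Fintype.card G.edgeSet : ℤ) * n + Fintype.card κ ≤
      S.card + (((Fintype.card V : ℤ) - 1) * n + 1) := by
    rw [← Nat.cast_one, ← Nat.cast_sub hV]
    exact_mod_cast key
  rw [graphEulerChar, Nat.card_eq_fintype_card, Nat.card_eq_fintype_card]
  linarith

theorem le_presentationDeficiency [Finite V] (htri : G.CliqueFree 3) (v₀ : V) {n : ℕ}
    (hn : 1 ≤ n) {d : ℤ} (hd : d ∈ presentationDeficiencies (RAAG.levelSubgroup G n)) :
    (n : ℤ) * (1 - graphEulerChar G) - 1 ≤ d := by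
  obtain ⟨m, f, hf, hfin, rfl⟩ := hd
  obtain ⟨S, hS, hcl⟩ := exists_finset_card_eq_normalRank hfin
  have := card_edge_add_le_of_presentation htri v₀ hn f hf S hcl
  rwa [hS, Fintype.card_fin] at this

theorem exists_finite_level_presentation [Finite V] (v₀ : V) {n : ℕ} (hn : 1 ≤ n) :
    ∃ (m : ℕ) (f : FreeGroup (Fin m) →* RAAG.levelSubgroup G n), Function.Surjective f ∧
      f.ker.IsFinitelyNormallyGenerated ∧
      (normalRank f.ker : ℤ) - (m : ℤ) ≤ (n : ℤ) * (1 - graphEulerChar G) - 1 := by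
  classical
  have := Fintype.ofFinite V
  obtain ⟨-, q, ρ, hq, -, -, -, hcl⟩ := exists_level_presentation (G := G) v₀ n hn
  -- Repetitions among the `ρ p` would only lower the cardinality, and only an upper bound is
  -- needed.
  obtain ⟨f, hf, hfin, hle⟩ := exists_presentation_fin q hq (Finset.univ.image ρ)
    (by simpa using hcl)
  refine ⟨_, f, hf, hfin, ?_⟩
  have hV : 1 ≤ Fintype.card V := Fintype.card_pos_iff.2 ⟨v₀⟩
  have h1 := hle.trans Finset.card_image_le
  have h2 : (normalRank f.ker : ℤ) ≤ Fintype.card G.edgeSet * n := by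
    simpa using (Nat.cast_le (α := ℤ)).2 h1
  have h3 : (Fintype.card (Option ({v // v ≠ v₀} × Fin n)) : ℤ) =
      ((Fintype.card V : ℤ) - 1) * n + 1 := by
    rw [← Nat.cast_one, ← Nat.cast_sub hV]
    simp [Fintype.card_subtype_compl]
  rw [h3, graphEulerChar, Nat.card_eq_fintype_card, Nat.card_eq_fintype_card]
  linarith

theorem level_isFinitelyPresented [Finite V] (v₀ : V) {n : ℕ} (hn : 1 ≤ n) :
    Group.IsFinitelyPresented (RAAG.levelSubgroup G n) := by
  obtain ⟨m, f, hf, hfin, -⟩ := exists_finite_level_presentation (G := G) v₀ hn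
  exact ⟨m, f, hf, hfin⟩

theorem level_isLeast [Finite V] (htri : G.CliqueFree 3) (v₀ : V) {n : ℕ} (hn : 1 ≤ n) :
    IsLeast (presentationDeficiencies (RAAG.levelSubgroup G n))
      ((n : ℤ) * (1 - graphEulerChar G) - 1) := by
  obtain ⟨m, f, hf, hfin, hle⟩ := exists_finite_level_presentation (G := G) v₀ hn
  refine ⟨?_, fun d hd => le_presentationDeficiency htri v₀ hn hd⟩
  have hd : (normalRank f.ker : ℤ) - (m : ℤ) ∈
      presentationDeficiencies (RAAG.levelSubgroup G n) := ⟨m, f, hf, hfin, rfl⟩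
  exact (le_antisymm hle (le_presentationDeficiency htri v₀ hn hd)) ▸ hd

end LevelPresentation

/-! ### The Bestvina–Brady kernel of a tree is free -/

section TreeKernel

variable {V : Type*} {G : SimpleGraph V}

/-- A standard generator of a right-angled Artin group. -/
def raagOf (G : SimpleGraph V) (v : V) : RAAG G :=
  raagMk G (FreeGroup.of v)

theorem toInt_raagOf (v : V) : RAAG.toInt G (raagOf G v) = Multiplicative.ofAdd 1 := by
  simp [raagOf, toInt_mk]

theorem raagOf_commute {v w : V} (h : G.Adj v w) :
    raagOf G v * raagOf G w = raagOf G w * raagOf G v := by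
  have : raagMk G (basisCommutator v w) = 1 :=
    mk_eq_one.2 (Subgroup.subset_normalClosure ⟨v, w, h, rfl⟩)
  rw [basisCommutator, map_mul, map_mul, map_mul, map_inv, map_inv, mul_inv_eq_one,
    mul_inv_eq_iff_eq_mul] at this
  exact this

theorem raag_hom_ext {H : Type*} [Group H] {α β : RAAG G →* H}
    (h : ∀ v, α (raagOf G v) = β (raagOf G v)) : α = β :=
  PresentedGroup.ext h

/-- In a tree with a root, every vertex other than the root has a parent, and every edge joins
a vertex to its parent. -/
theorem SimpleGraph.IsTree.exists_parent (hT : G.IsTree) (v₀ : V) :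
    ∃ p : V → V, (∀ v, v ≠ v₀ → G.Adj (p v) v ∧ G.dist v₀ (p v) < G.dist v₀ v) ∧
      ∀ v w, G.Adj v w → (w ≠ v₀ ∧ p w = v) ∨ (v ≠ v₀ ∧ p v = w) := by
  choose q hq using hT.connected.exists_walk_length_eq_dist v₀
  have hmin {v w : V} (h : G.Adj v w) (hd : G.dist v₀ w = G.dist v₀ v + 1) :
      w ≠ v₀ ∧ (q w).penultimate = v := by
    refine ⟨?_, ?_⟩
    · rintro rfl
      simp at hd
    -- Extending the geodesic to `v` by the edge gives a geodesic to `w`; paths in a tree are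
    -- unique, so it is `q w`.
    · have h1 : ((q v).concat h).length = G.dist v₀ w := by
        rw [SimpleGraph.Walk.length_concat, hq, hd]
      rw [(hT.existsUnique_path v₀ w).unique ((q w).isPath_of_length_eq_dist (hq w))
        (((q v).concat h).isPath_of_length_eq_dist h1), SimpleGraph.Walk.penultimate_concat]
  refine ⟨fun v => (q v).penultimate, fun v hv => ?_, fun v w h => ?_⟩
  · have hnil : ¬ (q v).Nil := SimpleGraph.Walk.not_nil_of_ne hv.symm
    have hadj := (q v).adj_penultimate hnil
    refine ⟨hadj, ?_⟩
    change G.dist v₀ (q v).penultimate < _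
    have h1 := SimpleGraph.dist_le (q v).dropLast
    have h2 := SimpleGraph.Walk.length_concat (q v).dropLast hadj
    rw [SimpleGraph.Walk.concat_dropLast, hq] at h2
    omega
  · rcases hT.dist_eq_dist_add_one_of_adj v₀ h with hd | hd
    · exact Or.inr (hmin h.symm hd)
    · exact Or.inl (hmin h hd)

/-- Recursion along a parent function. -/
theorem exists_parent_recursion {V M : Type*} (v₀ : V) (p : V → V) (dep : V → ℕ)
    (hp : ∀ v, v ≠ v₀ → dep (p v) < dep v) (m : M) (step : M → V → M) :
    ∃ W : V → M, W v₀ = m ∧ ∀ v, v ≠ v₀ → W v = step (W (p v)) v := by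
  classical
  let W : V → M := (measure dep).wf.fix fun v ih =>
    if h : v = v₀ then m else step (ih (p v) (hp v h)) v
  have hW (v) : W v = if v = v₀ then m else step (W (p v)) v := by
    simp only [W]
    rw [WellFounded.fix_eq]
    split_ifs <;> rfl
  exact ⟨W, by simp [hW v₀], fun v hv => by rw [hW v, if_neg hv]⟩

theorem parent_induction {V : Type*} (v₀ : V) (p : V → V) (dep : V → ℕ)
    (hp : ∀ v, v ≠ v₀ → dep (p v) < dep v) {P : V → Prop} (h₀ : P v₀)
    (hstep : ∀ v, v ≠ v₀ → P (p v) → P v) (v : V) : P v := by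
  induction v using (measure dep).wf.induction with
  | _ v ih =>
    by_cases h : v = v₀
    · exact h ▸ h₀
    · exact hstep v h (ih _ (hp v h))

/-- This supplies the compatibility needed to map out of a semidirect product with `ℤ` from the case
of its generator. -/
theorem zpow_semiconj {F H : Type*} [Group F] [Group H] (K : F →* H) (σ : MulAut F) (x : H)
    (h : ∀ f, K (σ f) = x * K f * x⁻¹) (k : ℤ) (f : F) :
    K ((σ ^ k) f) = x ^ k * K f * (x ^ k)⁻¹ := by
  induction k generalizing f with
  | zero => simp
  | succ k ih => rw [zpow_add_one, MulAut.mul_apply, ih, h, zpow_add_one]; group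
  | pred k ih =>
    have h' : K (σ⁻¹ f) = x⁻¹ * K f * x := by
      have := h (σ⁻¹ f)
      rw [MulAut.apply_inv_self] at this
      rw [this]
      group
    rw [zpow_sub_one, MulAut.mul_apply, ih, h', zpow_sub_one]
    group

/-- The Bestvina–Brady kernel of a tree is free on the edges of the tree. -/
theorem SimpleGraph.IsTree.nonempty_mulEquiv_bestvinaBrady (hT : G.IsTree) (v₀ : V) :
    Nonempty (FreeGroup {v // v ≠ v₀} ≃* RAAG.bestvinaBrady G) := by
  classical
  obtain ⟨p, hp, hpar⟩ := hT.exists_parent v₀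
  have hdep (v) (hv : v ≠ v₀) := (hp v hv).2
  -- Dictionary with the right-angled Artin group: `y v` stands for `(p v)⁻¹ v`, `W v` for `v₀⁻¹ v`
  -- and `U v` for `v v₀⁻¹`; the last uses that `v` commutes with `p v`. Then `σ₀` is conjugation by
  -- `v₀`, taking `W v` to `U v`, and `τ₀` is its inverse.
  let y (v : V) : FreeGroup {v // v ≠ v₀} := if h : v ≠ v₀ then FreeGroup.of ⟨v, h⟩ else 1
  have hy (a : {v // v ≠ v₀}) : y a = FreeGroup.of a := dif_pos a.2
  obtain ⟨W, hW0, hW⟩ := exists_parent_recursion v₀ p (G.dist v₀) hdep (1 : FreeGroup {v // v ≠ v₀})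
    fun w v => w * y v
  obtain ⟨U, hU0, hU⟩ := exists_parent_recursion v₀ p (G.dist v₀) hdep (1 : FreeGroup {v // v ≠ v₀})
    fun u v => y v * u
  let σ₀ : FreeGroup {v // v ≠ v₀} →* FreeGroup {v // v ≠ v₀} :=
    FreeGroup.lift fun a => (U (p a))⁻¹ * y a * U (p a)
  let τ₀ : FreeGroup {v // v ≠ v₀} →* FreeGroup {v // v ≠ v₀} :=
    FreeGroup.lift fun a => W (p a) * y a * (W (p a))⁻¹
  have hσy (v) (hv : v ≠ v₀) : σ₀ (y v) = (U (p v))⁻¹ * y v * U (p v) := by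
    rw [hy ⟨v, hv⟩, FreeGroup.lift_apply_of, hy ⟨v, hv⟩]
  have hτy (v) (hv : v ≠ v₀) : τ₀ (y v) = W (p v) * y v * (W (p v))⁻¹ := by
    rw [hy ⟨v, hv⟩, FreeGroup.lift_apply_of, hy ⟨v, hv⟩]
  have hσ : ∀ v, σ₀ (W v) = U v := by
    refine parent_induction v₀ p (G.dist v₀) hdep ?_ (fun v hv ih => ?_)
    · rw [hW0, hU0, map_one]
    · rw [hW v hv, map_mul, ih, hσy v hv, hU v hv]
      group
  have hτ : ∀ v, τ₀ (U v) = W v := by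
    refine parent_induction v₀ p (G.dist v₀) hdep ?_ (fun v hv ih => ?_)
    · rw [hW0, hU0, map_one]
    · rw [hU v hv, map_mul, ih, hτy v hv, hW v hv]
      group
  let σ : MulAut (FreeGroup {v // v ≠ v₀}) := MonoidHom.toMulEquiv σ₀ τ₀
    (by
      ext a
      rw [MonoidHom.comp_apply, ← hy, hσy _ a.2, map_mul, map_mul, map_inv, hτ, hτy _ a.2,
        MonoidHom.id_apply]
      group)
    (by
      ext a
      rw [MonoidHom.comp_apply, ← hy, hτy _ a.2, map_mul, map_mul, map_inv, hσ, hσy _ a.2,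
        MonoidHom.id_apply]
      group)
  have hσσ (f) : σ f = σ₀ f := rfl
  let t : FreeGroup {v // v ≠ v₀} ⋊[zpowersHom _ σ] Multiplicative ℤ :=
    SemidirectProduct.inr (Multiplicative.ofAdd 1)
  have ht (f : FreeGroup {v // v ≠ v₀}) :
      SemidirectProduct.inl (σ f) = t * SemidirectProduct.inl f * t⁻¹ := by
    have := SemidirectProduct.inl_aut (φ := zpowersHom _ σ) (Multiplicative.ofAdd 1) f
    simpa [zpowersHom_apply] using this
  -- Each vertex `v` will go to `t * W v`. After cancellation, the relation for the edge from `p v`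
  -- to `v` says that `σ` sends `W (p v) * y v * (W (p v))⁻¹` to `y v`.
  have hpcomm (v) (hv : v ≠ v₀) :
      (t * SemidirectProduct.inl (W (p v))) * (t * SemidirectProduct.inl (W v)) =
        (t * SemidirectProduct.inl (W v)) * (t * SemidirectProduct.inl (W (p v))) := by
    have h1 : σ (W (p v) * y v * (W (p v))⁻¹) = y v := by
      rw [hσσ, map_mul, map_mul, map_inv, hσ, hσy v hv]
      group
    have h2 := ht (W (p v) * y v * (W (p v))⁻¹)
    rw [h1] at h2
    have h3 : (SemidirectProduct.inl (y v) : FreeGroup {v // v ≠ v₀} ⋊[zpowersHom _ σ] _) * t =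
        t * SemidirectProduct.inl (W (p v)) * SemidirectProduct.inl (y v) *
          (SemidirectProduct.inl (W (p v)))⁻¹ := by
      rw [← eq_mul_inv_iff_mul_eq]
      refine h2.trans ?_
      simp only [map_mul, map_inv, mul_assoc]
    rw [hW v hv, map_mul]
    calc _ = t * SemidirectProduct.inl (W (p v)) * (t * SemidirectProduct.inl (W (p v)) *
          SemidirectProduct.inl (y v) * (SemidirectProduct.inl (W (p v)))⁻¹) *
            SemidirectProduct.inl (W (p v)) := by group
      _ = _ := by
        rw [← h3]
        group
  let Φ : RAAG G →* FreeGroup {v // v ≠ v₀} ⋊[zpowersHom _ σ] Multiplicative ℤ :=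
    PresentedGroup.toGroup (f := fun v => t * SemidirectProduct.inl (W v)) (by
      rintro r ⟨v, w, h, rfl⟩
      simp only [map_mul, map_inv, FreeGroup.lift_apply_of, mul_inv_eq_iff_eq_mul, one_mul]
      rcases hpar v w h with ⟨hw, rfl⟩ | ⟨hv, rfl⟩
      · exact hpcomm w hw
      · exact (hpcomm v hv).symm)
  have hΦ (v) : Φ (raagOf G v) = t * SemidirectProduct.inl (W v) := PresentedGroup.toGroup.of _
  let K : FreeGroup {v // v ≠ v₀} →* RAAG G :=
    FreeGroup.lift fun a => (raagOf G (p a))⁻¹ * raagOf G a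
  have hKy (v) (hv : v ≠ v₀) : K (y v) = (raagOf G (p v))⁻¹ * raagOf G v := by
    rw [hy ⟨v, hv⟩, FreeGroup.lift_apply_of]
  have hcomm (v) (hv : v ≠ v₀) := raagOf_commute (hp v hv).1
  have hKW : ∀ v, K (W v) = (raagOf G v₀)⁻¹ * raagOf G v := by
    refine parent_induction v₀ p (G.dist v₀) hdep ?_ (fun v hv ih => ?_)
    · rw [hW0]
      simp
    · rw [hW v hv, map_mul, ih, hKy v hv]
      group
  have hKU : ∀ v, K (U v) = raagOf G v * (raagOf G v₀)⁻¹ := by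
    refine parent_induction v₀ p (G.dist v₀) hdep ?_ (fun v hv ih => ?_)
    · rw [hU0]
      simp
    · rw [hU v hv, map_mul, ih, hKy v hv, ← mul_assoc, mul_assoc _ _ (raagOf G (p v)),
        ← hcomm v hv, inv_mul_cancel_left]
  have hKσ (f : FreeGroup {v // v ≠ v₀}) : K (σ f) = raagOf G v₀ * K f * (raagOf G v₀)⁻¹ := by
    have : K.comp σ₀ = (MulAut.conj (raagOf G v₀)).toMonoidHom.comp K := by
      ext a
      have h1 := hKU (p a)
      rw [MonoidHom.comp_apply, ← hy, hσy _ a.2, map_mul, map_mul, map_inv, h1]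
      simp only [MonoidHom.comp_apply, MulEquiv.toMonoidHom_eq_coe, MonoidHom.coe_coe,
        MulAut.conj_apply, hKy _ a.2]
      have h2 := hcomm a a.2
      simp only [mul_inv_rev, inv_inv, mul_assoc, mul_right_inj]
      rw [← mul_assoc (raagOf G a), ← h2, mul_assoc, inv_mul_cancel_left]
    exact DFunLike.congr_fun this f
  let Ψ : FreeGroup {v // v ≠ v₀} ⋊[zpowersHom _ σ] Multiplicative ℤ →* RAAG G :=
    SemidirectProduct.lift K (zpowersHom _ (raagOf G v₀)) (fun k => by
      ext1 a
      exact zpow_semiconj K σ (raagOf G v₀) hKσ k.toAdd (FreeGroup.of a))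
  have hΨΦ (g) : Ψ (Φ g) = g := by
    have : Ψ.comp Φ = MonoidHom.id _ := by
      apply raag_hom_ext
      intro v
      rw [MonoidHom.comp_apply, hΦ, map_mul, SemidirectProduct.lift_inl, hKW]
      simp [Ψ, t, zpowersHom_apply]
    exact DFunLike.congr_fun this g
  have hΦK (f) : Φ (K f) = SemidirectProduct.inl f := by
    have : Φ.comp K = SemidirectProduct.inl := by
      ext1 a
      rw [MonoidHom.comp_apply, ← hy, hKy _ a.2, map_mul, map_inv, hΦ, hΦ, hW _ a.2]
      simp [mul_assoc]
    exact DFunLike.congr_fun this f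
  have hright (g) : (Φ g).right = RAAG.toInt G g := by
    have : SemidirectProduct.rightHom.comp Φ = RAAG.toInt G := by
      apply raag_hom_ext
      intro v
      rw [MonoidHom.comp_apply, hΦ, toInt_raagOf]
      simp [t]
    exact DFunLike.congr_fun this g
  have hKmem (f) : K f ∈ RAAG.bestvinaBrady G := by
    rw [RAAG.bestvinaBrady, MonoidHom.mem_ker, ← hright, hΦK]
    rfl
  -- `Φ ∘ K = inl` makes `K` injective. An element of degree `0` has `Φ`-image in the free factor,
  -- so `Ψ ∘ Φ = id` exhibits it as a value of `K`.
  refine ⟨MulEquiv.ofBijective (K.codRestrict _ hKmem) ⟨?_, ?_⟩⟩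
  · intro f f' h
    have h1 : K f = K f' := congr_arg Subtype.val h
    have h2 := congr_arg Φ h1
    rw [hΦK, hΦK] at h2
    exact SemidirectProduct.inl_injective h2
  · rintro ⟨g, hg⟩
    refine ⟨(Φ g).left, Subtype.ext ?_⟩
    change K (Φ g).left = g
    have h1 : Φ g = SemidirectProduct.inl (Φ g).left := by
      refine SemidirectProduct.ext rfl ?_
      rw [hright]
      exact hg
    conv_rhs => rw [← hΨΦ g, h1]
    exact (SemidirectProduct.lift_inl ..).symm

end TreeKernel

/-! ### Finite presentability of the kernel -/

section FinitelyPresentedKernel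

variable {V : Type*} {G : SimpleGraph V}

/-- If the normaliser of the image of `j` contains the image of `none`, then every element of the
target is a product of an element of the image of `j` and a power of the image of `none`. -/
theorem exists_eq_mul_zpow {Q α : Type*} [Group Q] (π : FreeGroup (Option α) →* Q)
    (hnorm : ∀ a, π (FreeGroup.of none) * π (FreeGroup.of (some a)) *
      (π (FreeGroup.of none))⁻¹ ∈ (π.comp (FreeGroup.map some)).range)
    (hnorm' : ∀ a, (π (FreeGroup.of none))⁻¹ * π (FreeGroup.of (some a)) *
      π (FreeGroup.of none) ∈ (π.comp (FreeGroup.map some)).range) (w : FreeGroup (Option α)) :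
    ∃ (y : FreeGroup α) (k : ℤ), π w = π (FreeGroup.map some y) * π (FreeGroup.of none) ^ k := by
  set Y := (π.comp (FreeGroup.map some)).range with hY
  set z := π (FreeGroup.of none)
  have hconj (x : Q) (hx : ∀ a, x * π (FreeGroup.of (some a)) * x⁻¹ ∈ Y) (y) (hy : y ∈ Y) :
      x * y * x⁻¹ ∈ Y := by
    obtain ⟨f, rfl⟩ := hy
    induction f using FreeGroup.induction_on with
    | C1 => simp [hY]
    | of a => simpa using hx a
    | inv_of a ih =>
      have := inv_mem ih
      simpa [mul_assoc] using this
    | mul f g hf hg => simpa [mul_assoc] using mul_mem hf hg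
  have hz : z ∈ Subgroup.normalizer (Y : Set Q) := by
    rw [Subgroup.mem_normalizer_iff]
    intro y
    refine ⟨hconj z hnorm y, fun h => ?_⟩
    have := hconj z⁻¹ (by simpa using hnorm') _ h
    simpa [mul_assoc] using this
  have hzk (k : ℤ) {y : Q} (hy : y ∈ Y) : z ^ k * y * (z ^ k)⁻¹ ∈ Y :=
    (Subgroup.mem_normalizer_iff.1 (zpow_mem hz k) y).1 hy
  suffices h : ∃ y ∈ Y, ∃ k : ℤ, π w = y * z ^ k by
    obtain ⟨_, ⟨y, rfl⟩, k, h⟩ := h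
    exact ⟨y, k, h⟩
  have hof (o : Option α) : ∃ y ∈ Y, ∃ k : ℤ, π (FreeGroup.of o) = y * z ^ k := by
    cases o with
    | none => exact ⟨1, one_mem _, 1, by simp [z]⟩
    | some a => exact ⟨_, ⟨FreeGroup.of a, rfl⟩, 0, by simp⟩
  induction w using FreeGroup.induction_on with
  | C1 => exact ⟨1, one_mem _, 0, by simp⟩
  | of o => exact hof o
  | inv_of o _ =>
    obtain ⟨y, hy, k, h⟩ := hof o
    refine ⟨_, hzk (-k) (inv_mem hy), -k, ?_⟩
    rw [map_inv, h]
    group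
  | mul f g hf hg =>
    obtain ⟨y, hy, k, h⟩ := hf
    obtain ⟨y', hy', k', h'⟩ := hg
    refine ⟨_, mul_mem hy (hzk k hy'), k + k', ?_⟩
    rw [map_mul, h, h']
    group

theorem bestvinaBrady_le_levelSubgroup (n : ℕ) :
    RAAG.bestvinaBrady G ≤ RAAG.levelSubgroup G n := fun g hg => by
  rw [RAAG.levelSubgroup, Subgroup.mem_comap, (show RAAG.toInt G g = 1 from hg)]
  exact one_mem _

/-- A finite presentation of the Bestvina–Brady kernel gives presentations of all the level
subgroups with bounded numbers of generators and relators. -/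
theorem exists_level_presentation_of_kernel (v₀ : V) {n : ℕ} (hn : 1 ≤ n) {a : ℕ}
    (f₀ : FreeGroup (Fin a) →* RAAG.bestvinaBrady G) (hf₀ : Function.Surjective f₀)
    (T : Finset (FreeGroup (Fin a)))
    (hT : Subgroup.normalClosure (T : Set (FreeGroup (Fin a))) = f₀.ker) :
    ∃ (f : FreeGroup (Option (Fin a)) →* RAAG.levelSubgroup G n)
      (S : Finset (FreeGroup (Option (Fin a)))), Function.Surjective f ∧
      Subgroup.normalClosure (S : Set (FreeGroup (Option (Fin a)))) = f.ker ∧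
      S.card ≤ T.card + 2 * a := by
  classical
  let x : RAAG G := raagOf G v₀ ^ n
  have hx : RAAG.toInt G x = Multiplicative.ofAdd (n : ℤ) := by
    rw [map_pow, toInt_raagOf, ← ofAdd_nsmul]
    simp
  have hxmem : x ∈ RAAG.levelSubgroup G n := by
    rw [RAAG.levelSubgroup, Subgroup.mem_comap, hx]
    exact Subgroup.mem_zpowers _
  let f : FreeGroup (Option (Fin a)) →* RAAG.levelSubgroup G n :=
    FreeGroup.lift fun o => o.elim ⟨x, hxmem⟩
      fun i => ⟨f₀ (FreeGroup.of i), bestvinaBrady_le_levelSubgroup n (f₀ (FreeGroup.of i)).2⟩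
  let j : FreeGroup (Fin a) →* FreeGroup (Option (Fin a)) := FreeGroup.map some
  let z : FreeGroup (Option (Fin a)) := FreeGroup.of none
  have hfz : (f z : RAAG G) = x := by simp [f, z]
  have hfj (y) : (f (j y) : RAAG G) = f₀ y := by
    have : (Subgroup.subtype _).comp (f.comp j) = (Subgroup.subtype _).comp f₀ := by
      ext i
      simp [f, j]
    exact DFunLike.congr_fun this y
  have hnormal : (RAAG.bestvinaBrady G).Normal := MonoidHom.normal_ker _
  have hu (i : Fin a) : ∃ u, (f₀ u : RAAG G) = x * f₀ (FreeGroup.of i) * x⁻¹ := by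
    obtain ⟨u, hu⟩ := hf₀ ⟨_, hnormal.conj_mem _ (f₀ (FreeGroup.of i)).2 x⟩
    exact ⟨u, congr_arg Subtype.val hu⟩
  have hu' (i : Fin a) : ∃ u, (f₀ u : RAAG G) = x⁻¹ * f₀ (FreeGroup.of i) * x := by
    obtain ⟨u, hu⟩ := hf₀ ⟨_, hnormal.conj_mem _ (f₀ (FreeGroup.of i)).2 x⁻¹⟩
    exact ⟨u, by simpa using congr_arg Subtype.val hu⟩
  choose u hu using hu
  choose u' hu' using hu'
  -- Conjugation relators for both `z` and `z⁻¹` are included, so that modulo `S` the image of `j`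
  -- is normalised by `z` and not merely mapped into itself.
  let S : Finset (FreeGroup (Option (Fin a))) := T.image j ∪
    (Finset.univ.image fun i => z * j (FreeGroup.of i) * z⁻¹ * (j (u i))⁻¹) ∪
    Finset.univ.image fun i => z⁻¹ * j (FreeGroup.of i) * z * (j (u' i))⁻¹
  have hNf : Subgroup.normalClosure (S : Set (FreeGroup (Option (Fin a)))) ≤ f.ker := by
    apply Subgroup.normalClosure_le_normal
    intro s hs
    rw [SetLike.mem_coe, MonoidHom.mem_ker, Subtype.ext_iff]
    simp only [S, Finset.coe_union, Finset.coe_image, Finset.coe_univ, Set.image_univ,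
      Set.mem_union, Set.mem_image, Set.mem_range] at hs
    rcases hs with (⟨t, ht, rfl⟩ | ⟨i, rfl⟩) | ⟨i, rfl⟩
    · have : t ∈ f₀.ker := hT ▸ Subgroup.subset_normalClosure ht
      rw [hfj, MonoidHom.mem_ker.1 this]
      rfl
    · simp [hfj, hfz, hu]
    · simp [hfj, hfz, hu', mul_assoc]
  refine ⟨f, S, ?_, le_antisymm hNf ?_, ?_⟩
  · rintro ⟨g, hg⟩
    obtain ⟨k, hk⟩ := Subgroup.mem_zpowers_iff.1 (Subgroup.mem_comap.1 hg)
    have hmem : g * (x ^ k)⁻¹ ∈ RAAG.bestvinaBrady G := by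
      rw [RAAG.bestvinaBrady, MonoidHom.mem_ker, map_mul, map_inv, map_zpow, hx, hk,
        mul_inv_cancel]
    obtain ⟨y, hy⟩ := hf₀ ⟨_, hmem⟩
    refine ⟨j y * z ^ k, Subtype.ext ?_⟩
    simp [hfj, hfz, hy]
  · let N := Subgroup.normalClosure (S : Set (FreeGroup (Option (Fin a))))
    have hN {s} (hs : s ∈ S) : s ∈ N := Subgroup.subset_normalClosure hs
    intro w hw
    -- Modulo `N`, `w` is `j y * z ^ k`. If `w` lies in `f.ker`, the degree `k * n` vanishes, so `k
    -- = 0` and `y` is a consequence of `T`.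
    obtain ⟨y, k, h⟩ := exists_eq_mul_zpow (QuotientGroup.mk' N)
      (fun i => ⟨u i, by
        symm
        rw [← map_mul, ← map_inv, ← map_mul, MonoidHom.comp_apply, ← mul_inv_eq_one, ← map_inv,
          ← map_mul, ← MonoidHom.mem_ker, QuotientGroup.ker_mk']
        exact hN (by simp [S, j, z])⟩)
      (fun i => ⟨u' i, by
        symm
        rw [← map_inv, ← map_mul, ← map_mul, MonoidHom.comp_apply, ← mul_inv_eq_one, ← map_inv,
          ← map_mul, ← MonoidHom.mem_ker, QuotientGroup.ker_mk']
        exact hN (by simp [S, j, z])⟩) w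
    rw [← map_zpow, ← map_mul] at h
    have h1 : w * (j y * z ^ k)⁻¹ ∈ N := by
      rw [← QuotientGroup.ker_mk' N, MonoidHom.mem_ker, map_mul, map_inv, mul_inv_eq_one]
      exact h
    have h2 : j y * z ^ k ∈ f.ker := by
      have := mul_mem (inv_mem (hNf h1)) hw
      simpa using this
    have h3 : (f₀ y : RAAG G) * x ^ k = 1 := by
      have := congr_arg Subtype.val (MonoidHom.mem_ker.1 h2)
      simpa [hfj, hfz] using this
    have hk : k = 0 := by
      have h4 := congr_arg (RAAG.toInt G) h3
      rw [map_mul, map_one, (show RAAG.toInt G (f₀ y) = 1 from (f₀ y).2), one_mul, map_zpow, hx,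
        ← ofAdd_zsmul, ofAdd_eq_one, smul_eq_mul, mul_eq_zero] at h4
      rcases h4 with h4 | h4
      · exact h4
      · omega
    subst hk
    rw [zpow_zero, mul_one] at h1 h3
    have h5 : y ∈ Subgroup.normalClosure (T : Set (FreeGroup (Fin a))) := by
      rw [hT, MonoidHom.mem_ker]
      exact Subtype.ext h3
    have h6 : Subgroup.normalClosure (T : Set (FreeGroup (Fin a))) ≤ N.comap j := by
      apply Subgroup.normalClosure_le_normal
      intro t ht
      exact hN (by
        simp only [S, Finset.mem_union, Finset.mem_image]
        exact Or.inl (Or.inl ⟨t, ht, rfl⟩))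
    have := mul_mem h1 (h6 h5)
    simpa using this
  · refine (Finset.card_union_le _ _).trans ?_
    have h1 := Finset.card_union_le (T.image j)
      (Finset.univ.image fun i => z * j (FreeGroup.of i) * z⁻¹ * (j (u i))⁻¹)
    have h2 := Finset.card_image_le (s := T) (f := j)
    have h3 := Finset.card_image_le (s := Finset.univ)
      (f := fun i => z * j (FreeGroup.of i) * z⁻¹ * (j (u i))⁻¹)
    have h4 := Finset.card_image_le (s := Finset.univ)
      (f := fun i => z⁻¹ * j (FreeGroup.of i) * z * (j (u' i))⁻¹)
    rw [Finset.card_univ, Fintype.card_fin] at h3 h4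
    omega

theorem one_le_graphEulerChar_of_isFinitelyPresented [Finite V]
    (htri : G.CliqueFree 3) (v₀ : V) (h : Group.IsFinitelyPresented (RAAG.bestvinaBrady G)) :
    1 ≤ graphEulerChar G := by
  obtain ⟨a, f₀, hf₀, T, hT, hcl⟩ := h
  lift T to Finset (FreeGroup (Fin a)) using hT
  by_contra! hχ
  -- With `a + 1` generators and at most `T.card + 2 * a` relators, the lower bound for `χ ≤ 0`
  -- gives `n - 1 ≤ T.card + a - 1`, which this `n` just violates.
  let n := T.card + a + 1
  obtain ⟨f, S, hf, hS, hcard⟩ := exists_level_presentation_of_kernel v₀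
    (show 1 ≤ n by omega) f₀ hf₀ T hcl
  have h1 := card_edge_add_le_of_presentation htri v₀ (show 1 ≤ n by omega) f hf S hS
  rw [Fintype.card_option, Fintype.card_fin] at h1
  have h2 : (n : ℤ) * 1 ≤ n * (1 - graphEulerChar G) :=
    mul_le_mul_of_nonneg_left (by omega) (by omega)
  have h3 : (n : ℤ) = T.card + a + 1 := by simp [n]
  push_cast at h1
  omega

/-- A connected graph has `χ ≤ 1`, with equality exactly for trees. -/
theorem one_le_graphEulerChar_iff [Finite V] (hconn : G.Connected) :
    1 ≤ graphEulerChar G ↔ G.IsTree := by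
  have := hconn.card_vert_le_card_edgeSet_add_one
  rw [SimpleGraph.isTree_iff_connected_and_card, graphEulerChar]
  constructor
  · intro h
    exact ⟨hconn, by omega⟩
  · rintro ⟨-, h⟩
    omega

theorem bestvinaBrady_isFinitelyPresented_iff [Finite V] (hconn : G.Connected)
    (htri : G.CliqueFree 3) : Group.IsFinitelyPresented (RAAG.bestvinaBrady G) ↔ G.IsTree := by
  obtain ⟨v₀⟩ := hconn.nonempty
  constructor
  · intro h
    exact (one_le_graphEulerChar_iff hconn).1
      (one_le_graphEulerChar_of_isFinitelyPresented htri v₀ h)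
  · intro h
    obtain ⟨e⟩ := h.nonempty_mulEquiv_bestvinaBrady v₀
    exact Group.IsFinitelyPresented.equiv e

theorem tendsto_atTop_iff_one_le {χ : ℤ} {d : ℕ → ℤ}
    (hd : ∀ n : ℕ, 1 ≤ n → d n = n * (1 - χ) - 1) :
    Filter.Tendsto d Filter.atTop Filter.atTop ↔ ¬ 1 ≤ χ := by
  constructor
  · intro h hχ
    obtain ⟨n, hn, hn'⟩ := ((h.eventually_ge_atTop 0).and (Filter.eventually_ge_atTop 1)).exists
    rw [hd n hn'] at hn
    have : (n : ℤ) * (1 - χ) ≤ 0 := mul_nonpos_of_nonneg_of_nonpos (by omega) (by omega)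
    omega
  · intro hχ
    refine Filter.tendsto_atTop.2 fun b => ?_
    filter_upwards [Filter.eventually_ge_atTop (b.toNat + 1)] with n hn
    rw [hd n (by omega)]
    have : (n : ℤ) * 1 ≤ n * (1 - χ) := mul_le_mul_of_nonneg_left (by omega) (by omega)
    omega

end FinitelyPresentedKernel

theorem corollary4p4 {V : Type*} [Finite V] (G : SimpleGraph V)
    (hconn : G.Connected) (htri : G.CliqueFree 3) :
    -- for `n ≥ 1` the group `Γ_n` is finitely presented, the infimum that defines its deficiency
    -- is a genuine one (and attained), and it has the stated value
    (∀ n : ℕ, 1 ≤ n →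
      Group.IsFinitelyPresented (RAAG.levelSubgroup G n) ∧
      IsLeast (presentationDeficiencies (RAAG.levelSubgroup G n))
        ((n : ℤ) * (1 - graphEulerChar G) - 1) ∧
      deficiency (RAAG.levelSubgroup G n) = (n : ℤ) * (1 - graphEulerChar G) - 1) ∧
    (Filter.Tendsto (fun n : ℕ => deficiency (RAAG.levelSubgroup G n))
        Filter.atTop Filter.atTop ↔
      ¬ Group.IsFinitelyPresented (RAAG.bestvinaBrady G)) ∧
    (¬ Group.IsFinitelyPresented (RAAG.bestvinaBrady G) ↔ ¬ G.IsTree) := by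
  obtain ⟨v₀⟩ := hconn.nonempty
  -- The existence of a least element rules out the default value of `sInf` on `ℤ`.
  have hdef (n : ℕ) (hn : 1 ≤ n) : deficiency (RAAG.levelSubgroup G n) =
      (n : ℤ) * (1 - graphEulerChar G) - 1 := (level_isLeast htri v₀ hn).csInf_eq
  refine ⟨fun n hn => ⟨level_isFinitelyPresented v₀ hn, level_isLeast htri v₀ hn, hdef n hn⟩,
    ?_, not_congr (bestvinaBrady_isFinitelyPresented_iff hconn htri)⟩
  rw [tendsto_atTop_iff_one_le hdef, one_le_graphEulerChar_iff hconn,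
    bestvinaBrady_isFinitelyPresented_iff hconn htri]
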